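/- Let $d\in\mathbb N$ and $\lambda\in(0,1)$. Let $\Omega_0$ be the set of diagonal matrices $\operatorname{diag}(a_1,\dots,a_d)\in\mathbb R^{d\times d}$ with $a_i\in(\lambda,1)$ for all $i$, let $\Omega=\Omega_0^{\mathbb Z^d}$ be the set of all $a:\mathbb Z^d\to\Omega_0$ with the product $\sigma$-algebra of the Borel $\sigma$-algebras, and let $\tau_z a=a(\cdot+z)$ for $z\in\mathbb Z^d$. Let $\mathbb P$ be a probability measure on $\Omega$, with expectation $\mathbb E$, that is stationary: every $\tau_z$, $z\in\mathbb Z^d$, preserves $\mathbb P$. Call $\mathbb P$ ergodic if $\mathbb P(A)\in\{0,1\}$ for every measurable $A\subset\Omega$ that is invariant under all $\tau_z$. For $u\in L^2(\Omega)$ and $F\in L^2(\Omega)^d$ set $D_iu(a)=u(\tau_{e_i}a)-u(a)$, $D_i^*u(a)=u(\tau_{-e_i}a)-u(a)$, $Du=(D_1u,\dots,D_du)$ and $D^*F=\sum_{i=1}^dD_i^*F_i$; then $D^*D$ is a bounded linear operator on $L^2(\Omega)$, and we set $P(t)=\exp(-tD^*D)$ for $t\ge0$. For $f\in L^1(\Omega)$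 and $x\in\mathbb Z^d$ let $\partial_xf=f-\mathbb E[f\mid\mathcal F_x]$, where $\mathcal F_x$ is the $\sigma$-algebra generated by the evaluations $a\mapsto a(z)$, $z\in\mathbb Z^d\setminus\{x\}$. For $\rho>0$ we say that $\mathbb P$ satisfies (SG) with constant $\rho$ if $$\mathbb E\big[(f-\mathbb E[f])^2\big]\le\frac1\rho\sum_{x\in\mathbb Z^d}\mathbb E\big[(\partial_xf)^2\big]\qquad\text{for all }f\in L^2(\Omega).$$ (Here and below the sums over $x$ may equal $+\infty$.) Then: (a) $\mathbb P$ is ergodic if and only if $$\lim_{t\to\infty}\mathbb E\big[|P(t)\zeta-\mathbb E[\zeta]|^2\big]=0\qquad\text{for all }\zeta\in L^2(\Omega).$$ (b) There is a constant $C(d)\in(0,\infty)$ depending only on $d$ such that, if $\mathbb P$ satisfies (SG) with constant $\rho>0$, then for all $\zeta\in L^2(\Omega)$ and all $t\ge0$ $$\mathbb E\big[|P(t)\zeta-\mathbb E[\zeta]|^2\big]^{\frac12}\le\frac{C(d)}{\sqrt\rho}\,(t+1)^{-\frac d4}\sum_{x\in\mathbb Z^d}\mathbb E\big[|\partial_x\zeta|^2\big]^{\frac12}.$$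 -/

import Mathlib

open MeasureTheory Filter Topology
open scoped ENNReal

namespace DiscreteHomog

/-- The set `Ω₀` of diagonal matrices `diag(a₁, …, a_d)` with all `aᵢ ∈ (lam, 1)`. -/
def Coeff (d : ℕ) (lam : ℝ) : Type :=
  {A : Matrix (Fin d) (Fin d) ℝ //
    ∃ v : Fin d → ℝ, (∀ i, v i ∈ Set.Ioo lam 1) ∧ A = Matrix.diagonal v}

/-- `Ω₀` carries the trace of the Borel sigma-algebra of `ℝ^{d×d}`. -/
instance Coeff.instMeasurableSpace (d : ℕ) (lam : ℝ) : MeasurableSpace (Coeff d lam) :=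
  MeasurableSpace.comap Subtype.val (borel (Matrix (Fin d) (Fin d) ℝ))

/-- The configuration space `Ω` of all fields `a : ℤ^d → Ω₀`, with the product sigma-algebra. -/
abbrev Config (d : ℕ) (lam : ℝ) : Type := (Fin d → ℤ) → Coeff d lam

/-- The shift `τ_z a = a(· + z)`. -/
def shift {d : ℕ} {lam : ℝ} (z : Fin d → ℤ) (a : Config d lam) : Config d lam :=
  fun x => a (x + z)

/-- Stationarity: every shift preserves the measure. -/
def Stationary {d : ℕ} {lam : ℝ} (P : Measure (Config d lam)) : Prop :=
  ∀ z : Fin d → ℤ, MeasurePreserving (shift z) P P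

/-- Ergodicity: every measurable shift invariant set has probability `0` or `1`. -/
def IsErgodic {d : ℕ} {lam : ℝ} (P : Measure (Config d lam)) : Prop :=
  ∀ A : Set (Config d lam), MeasurableSet A → (∀ z : Fin d → ℤ, shift z ⁻¹' A = A) →
    P A = 0 ∨ P A = 1

/-- The Hilbert space `L²(Ω)`. -/
abbrev L2 {d : ℕ} {lam : ℝ} (P : Measure (Config d lam)) : Type := Lp ℝ 2 P

/-- The operator `ζ ↦ ζ ∘ τ_z` on `L²(Ω)`. -/
noncomputable def shiftOp {d : ℕ} {lam : ℝ} {P : Measure (Config d lam)} (hP : Stationary P)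
    (z : Fin d → ℤ) : L2 P →L[ℝ] L2 P :=
  (Lp.compMeasurePreservingₗᵢ ℝ (shift z) (hP z)).toContinuousLinearMap

/-- The horizontal derivative `D = (D₁, …, D_d)`, `Dᵢ u = u ∘ τ_{eᵢ} - u`. -/
noncomputable def horizD {d : ℕ} {lam : ℝ} {P : Measure (Config d lam)} (hP : Stationary P) :
    L2 P →L[ℝ] (Fin d → L2 P) :=
  ContinuousLinearMap.pi fun i =>
    shiftOp hP (Pi.single i 1) - ContinuousLinearMap.id ℝ (L2 P)

/-- The operator `D* F = ∑ᵢ Dᵢ* Fᵢ`, `Dᵢ* u = u ∘ τ_{-eᵢ} - u`. -/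
noncomputable def horizDstar {d : ℕ} {lam : ℝ} {P : Measure (Config d lam)} (hP : Stationary P) :
    (Fin d → L2 P) →L[ℝ] L2 P :=
  ∑ i : Fin d, (shiftOp hP (-Pi.single i 1) - ContinuousLinearMap.id ℝ (L2 P)).comp
    (ContinuousLinearMap.proj i)

/-- The semigroup `P(t) = exp(-t D*D)` on `L²(Ω)` (exponential of a bounded operator). -/
noncomputable def semigroup {d : ℕ} {lam : ℝ} {P : Measure (Config d lam)} (hP : Stationary P)
    (t : ℝ) : L2 P →L[ℝ] L2 P :=
  NormedSpace.exp ((-t) • (horizDstar hP).comp (horizD hP))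

/-- The sigma-algebra `F_x` generated by the evaluations `a ↦ a(z)`, `z ≠ x`. -/
@[reducible] def sigmaAway (d : ℕ) (lam : ℝ) (x : Fin d → ℤ) : MeasurableSpace (Config d lam) :=
  ⨆ (z : Fin d → ℤ) (_ : z ≠ x),
    MeasurableSpace.comap (fun a : Config d lam => a z) (Coeff.instMeasurableSpace d lam)

/-- The vertical derivative `∂_x f = f - E[f | F_x]`. -/
noncomputable def vertD {d : ℕ} {lam : ℝ} (P : Measure (Config d lam)) (x : Fin d → ℤ)
    (f : Config d lam → ℝ) : Config d lam → ℝ :=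
  fun a => f a - (P[f | sigmaAway d lam x]) a

/-- The spectral gap estimate with constant `ρ`:
`E[(f - E f)²] ≤ (1/ρ) ∑_x E[(∂_x f)²]` for all `f ∈ L²(Ω)`.  The sum may be infinite, so
the inequality is one in `[0, ∞]`; `E[g²]` is written as the square of the `L²` norm. -/
def SpectralGap {d : ℕ} {lam : ℝ} (P : Measure (Config d lam)) (ρ : ℝ) : Prop :=
  ∀ f : L2 P,
    (eLpNorm (fun a => f a - ∫ b, f b ∂P) 2 P) ^ 2 ≤
      ENNReal.ofReal (1 / ρ) * ∑' x : Fin d → ℤ, (eLpNorm (vertD P x f) 2 P) ^ 2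

end DiscreteHomog

/-! (a) Write `S_z` for composition with `τ_z`. Then `D*D = ∑ᵢ (2 - S_{eᵢ} - S_{-eᵢ})` is
self-adjoint and `P(t)` is a contraction semigroup, so `P(t)ζ` converges to some `y` with `D*D y =
0` (`exists_tendsto_exp_neg_smul`). As `⟨D*D y, y⟩ = ∑ᵢ ‖Dᵢ y‖²`, this `y` is shift invariant;
ergodicity makes it constant, and preservation of the mean identifies the constant. Conversely,
`P(t)` fixes the indicator of an invariant set, so decay forces the indicator to be constant.

(b) The shifts commute, so `P(t) = B A` with `A = exp(t ∑ᵢ (S_{eᵢ} - 1))` and `B` its analogue for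
`-eᵢ` (`semigroup_eq_mul`). `B` is a contraction fixing constants, so it suffices to apply (SG) to
`Aζ`. `A` averages over shifts by independent Poisson numbers of steps, and `∂_x S_z = S_z ∂_{x-z}`;
hence `‖∂_x Aζ‖` is at most the convolution of a product Poisson kernel `K` with `‖∂_y ζ‖`
(`enorm_vertOp_exp_sum_le`). Young's inequality `ℓ² * ℓ¹ ⊂ ℓ²` and `∑ K² ≲ (t+1)^{-d/2}`
(`poissonWeight_le`) give the rate. One-sided walks make the kernel explicit, so no heat kernel
estimate is needed. -/

namespace DiscreteHomog

/-! ### Exponentials of bounded operators -/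

section AbstractSemigroup

variable {E : Type*} [NormedAddCommGroup E] [NormedSpace ℝ E] [CompleteSpace E]

theorem hasSum_exp_apply (A : E →L[ℝ] E) (v : E) :
    HasSum (fun n : ℕ => ((n.factorial : ℝ)⁻¹) • (A ^ n) v) (NormedSpace.exp A v) := by
  have h := NormedSpace.exp_series_hasSum_exp' (𝕂 := ℝ) A
  exact h.mapL (ContinuousLinearMap.apply ℝ E v)

theorem hasSum_map_exp_apply {F : Type*} [NormedAddCommGroup F] [NormedSpace ℝ F]
    (L : E →L[ℝ] F) (A : E →L[ℝ] E) (v : E) :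
    HasSum (fun n : ℕ => ((n.factorial : ℝ)⁻¹) • L ((A ^ n) v)) (L (NormedSpace.exp A v)) := by
  simpa using (hasSum_exp_apply A v).mapL L

theorem exp_apply_of_apply_eq_zero {A : E →L[ℝ] E} {v : E} (h : A v = 0) :
    NormedSpace.exp A v = v := by
  refine (hasSum_exp_apply A v).unique ?_
  convert! hasSum_ite_eq 0 v using 2 with n
  rcases n with _ | n
  · simp
  · simp [pow_succ, h]

theorem map_exp_apply_of_comp_eq_zero {F : Type*} [NormedAddCommGroup F] [NormedSpace ℝ F]
    {L : E →L[ℝ] F} {A : E →L[ℝ] E} (h : ∀ v, L (A v) = 0) (v : E) :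
    L (NormedSpace.exp A v) = L v := by
  refine (hasSum_map_exp_apply L A v).unique ?_
  convert! hasSum_ite_eq 0 (L v) using 2 with n
  rcases n with _ | n
  · simp
  · simp [pow_succ', h]

theorem norm_exp_apply_le (A : E →L[ℝ] E) (v : E) :
    ‖NormedSpace.exp A v‖ ≤ Real.exp ‖A‖ * ‖v‖ := by
  have hs : HasSum (fun n : ℕ => ((n.factorial : ℝ)⁻¹) • ‖A‖ ^ n) (Real.exp ‖A‖) := by
    rw [Real.exp_eq_exp_ℝ]
    exact NormedSpace.exp_series_hasSum_exp' (𝕂 := ℝ) ‖A‖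
  refine (hasSum_exp_apply A v).norm_le_of_bounded (hs.mul_right ‖v‖) fun n => ?_
  rw [norm_smul, norm_inv, Real.norm_natCast, smul_eq_mul, mul_assoc]
  gcongr
  rcases Nat.eq_zero_or_pos n with rfl | hn
  · simp
  · refine (ContinuousLinearMap.le_opNorm _ _).trans ?_
    gcongr
    exact norm_pow_le' A hn

theorem exp_smul_sub_smul_one (K : E →L[ℝ] E) (t c : ℝ) :
    NormedSpace.exp (t • (K - c • (1 : E →L[ℝ] E))) =
      Real.exp (-(t * c)) • NormedSpace.exp (t • K) := by
  let _ : NormedAlgebra ℚ (E →L[ℝ] E) := NormedAlgebra.restrictScalars ℚ ℝ _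
  have h1 : t • (K - c • (1 : E →L[ℝ] E)) =
      algebraMap ℝ (E →L[ℝ] E) (-(t * c)) + t • K := by
    rw [Algebra.algebraMap_eq_smul_one, smul_sub, smul_smul, neg_smul]; abel
  rw [h1, NormedSpace.exp_add_of_commute (Algebra.commutes _ _),
    ← NormedSpace.algebraMap_exp_comm, ← Real.exp_eq_exp_ℝ, ← Algebra.smul_def]

/-- The scalar part contributes `e^{-tc}`, which absorbs the power series bound `e^{t‖K‖}`. -/
theorem norm_exp_smul_sub_apply_le {K : E →L[ℝ] E} {c t : ℝ} (hK : ‖K‖ ≤ c) (ht : 0 ≤ t) (v : E) :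
    ‖NormedSpace.exp (t • (K - c • (1 : E →L[ℝ] E))) v‖ ≤ ‖v‖ := by
  rw [exp_smul_sub_smul_one, smul_apply, norm_smul, Real.norm_eq_abs,
    Real.abs_exp]
  calc Real.exp (-(t * c)) * ‖NormedSpace.exp (t • K) v‖
      ≤ Real.exp (-(t * c)) * (Real.exp (t * c) * ‖v‖) := by
        gcongr
        refine (norm_exp_apply_le _ v).trans ?_
        gcongr
        rw [norm_smul, Real.norm_of_nonneg ht]
        gcongr
    _ = ‖v‖ := by rw [← mul_assoc, ← Real.exp_add]; simp

end AbstractSemigroup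

/-! ### Long-time limits of self-adjoint contraction semigroups -/

section SelfAdjointSemigroup

variable {H : Type*} [NormedAddCommGroup H] [InnerProductSpace ℝ H] [CompleteSpace H]

theorem exp_neg_smul_add (T : H →L[ℝ] H) (s t : ℝ) :
    NormedSpace.exp ((-(s + t)) • T) =
      NormedSpace.exp ((-s) • T) * NormedSpace.exp ((-t) • T) := by
  let _ : NormedAlgebra ℚ (H →L[ℝ] H) := NormedAlgebra.restrictScalars ℚ ℝ _
  rw [neg_add, add_smul]
  exact NormedSpace.exp_add_of_commute
    (((Commute.refl T).smul_left _).smul_right _)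

theorem apply_eq_zero_of_exp_apply_eq {T : H →L[ℝ] H} {y : H}
    (h : ∀ t : ℝ, 0 ≤ t → NormedSpace.exp ((-t) • T) y = y) : T y = 0 := by
  -- Extending the identity to negative times gives a two-sided derivative at `0`.
  have hall : ∀ t : ℝ, NormedSpace.exp (t • T) y = y := by
    intro t
    rcases le_total t 0 with ht | ht
    · simpa using h (-t) (by linarith)
    · have h1 := h t ht
      have h2 : NormedSpace.exp (t • T) (NormedSpace.exp ((-t) • T) y) = y := by
        have := exp_neg_smul_add T (-t) t
        rw [neg_add_cancel, neg_zero, zero_smul, NormedSpace.exp_zero, neg_neg] at this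
        have h3 := congrArg (fun A : H →L[ℝ] H => A y) this
        simpa using h3.symm
      rwa [h1] at h2
  have hd := hasDerivAt_exp_smul_const (𝕂 := ℝ) T 0
  have hd2 := (ContinuousLinearMap.apply ℝ H y).hasFDerivAt.comp_hasDerivAt (0 : ℝ) hd
  have hd3 : HasDerivAt (fun _ : ℝ => y) (T y) 0 := by
    convert! hd2 using 1
    · ext t; simp [hall]
    · simp
  exact hd3.unique (hasDerivAt_const _ _)

/-- Self-adjointness gives `⟨U s x, U t x⟩ = ‖U((s+t)/2) x‖²`, so `‖U s x - U t x‖²` is a second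
difference of the nonincreasing function `φ(t) = ‖U t x‖²`. Convergence of `φ` thus makes the orbit
Cauchy, and its limit is fixed by every `U s`. -/
theorem exists_tendsto_exp_neg_smul {T : H →L[ℝ] H} (hT : IsSelfAdjoint T)
    (hc : ∀ t : ℝ, 0 ≤ t → ∀ v, ‖NormedSpace.exp ((-t) • T) v‖ ≤ ‖v‖) (x : H) :
    ∃ y, T y = 0 ∧ Tendsto (fun t : ℝ => NormedSpace.exp ((-t) • T) x) atTop (𝓝 y) := by
  set U : ℝ → H →L[ℝ] H := fun t => NormedSpace.exp ((-t) • T) with hU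
  have hadd : ∀ s t v, U (s + t) v = U s (U t v) := fun s t v => by
    simp only [hU, exp_neg_smul_add, mul_apply_eq_comp]
  have hsa : ∀ t, IsSelfAdjoint (U t) := fun t =>
    IsSelfAdjoint.exp ((IsSelfAdjoint.all (-t)).smul hT)
  have hin : ∀ s t, inner ℝ (U s x) (U t x) = ‖U ((s + t) / 2) x‖ ^ 2 := by
    have key : ∀ s t v w, inner ℝ (U s v) (U t w) = inner ℝ v (U (s + t) w) := by
      intro s t v w
      rw [hadd]
      exact (hsa s).isSymmetric v (U t w)
    intro s t
    rw [← real_inner_self_eq_norm_sq, key, key, add_halves]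
  set φ : ℝ → ℝ := fun t => ‖U t x‖ ^ 2 with hφ
  have hanti : AntitoneOn φ (Set.Ici 0) := by
    intro s _ t _ hst
    have : U t x = U (t - s) (U s x) := by rw [← hadd, sub_add_cancel]
    simp only [hφ, this]
    gcongr
    exact hc _ (by linarith) _
  obtain ⟨l, hl⟩ : ∃ l, Tendsto φ atTop (𝓝 l) := by
    have hanti' : Antitone fun t => φ (max t 0) := fun s t hst =>
      hanti (Set.mem_Ici.2 (le_max_right _ _)) (Set.mem_Ici.2 (le_max_right _ _))
        (max_le_max_right 0 hst)
    refine ⟨_, (tendsto_atTop_ciInf hanti' ⟨0, ?_⟩).congr' ?_⟩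
    · rintro _ ⟨t, rfl⟩; positivity
    · filter_upwards [eventually_ge_atTop 0] with t ht
      rw [max_eq_left ht]
  have hdist : ∀ s t, ‖U s x - U t x‖ ^ 2 = φ s - 2 * φ ((s + t) / 2) + φ t := by
    intro s t
    rw [norm_sub_sq_real, hin]
  have hcauchy : Cauchy (map (fun t => U t x) atTop) := by
    rw [Metric.cauchy_iff]
    refine ⟨inferInstance, fun ε hε => ?_⟩
    -- The second difference has weights `1, -2, 1`, so four errors of `ε²/4` add up to `ε²`.
    obtain ⟨N, hN⟩ := (Metric.tendsto_atTop.1 hl) (ε ^ 2 / 4) (by positivity)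
    refine ⟨(fun t => U t x) '' Set.Ici N, image_mem_map (Ici_mem_atTop N), ?_⟩
    rintro _ ⟨s, hs, rfl⟩ _ ⟨t, ht, rfl⟩
    rw [Set.mem_Ici] at hs ht
    have h1 := abs_lt.1 (hN s hs)
    have h2 := abs_lt.1 (hN t ht)
    have h3 := abs_lt.1 (hN ((s + t) / 2) (by linarith))
    rw [dist_eq_norm]
    refine lt_of_pow_lt_pow_left₀ 2 hε.le ?_
    rw [hdist]
    linarith [h1.2, h2.2, h3.1]
  obtain ⟨y, hy⟩ := CompleteSpace.complete hcauchy
  have hy : Tendsto (fun t => U t x) atTop (𝓝 y) := hy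
  refine ⟨y, apply_eq_zero_of_exp_apply_eq fun s _ => ?_, hy⟩
  have h1 : Tendsto (fun t => U s (U t x)) atTop (𝓝 (U s y)) :=
    ((U s).continuous.tendsto y).comp hy
  have h2 : Tendsto (fun t => U (s + t) x) atTop (𝓝 y) :=
    hy.comp (tendsto_atTop_add_const_left _ s tendsto_id)
  exact tendsto_nhds_unique (h1.congr fun t => (hadd s t x).symm) h2

end SelfAdjointSemigroup

/-! ### Uniform bound on Poisson weights -/

section Poisson

/-- The weights of the Poisson distribution with mean `t`. -/
noncomputable def poissonWeight (t : ℝ) (n : ℕ) : ℝ := Real.exp (-t) * (t ^ n / n.factorial)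

theorem poissonWeight_nonneg {t : ℝ} (ht : 0 ≤ t) (n : ℕ) : 0 ≤ poissonWeight t n := by
  unfold poissonWeight; positivity

theorem hasSum_poissonWeight (t : ℝ) : HasSum (poissonWeight t) 1 := by
  have h : HasSum (fun n : ℕ => t ^ n / n.factorial) (Real.exp t) := by
    rw [Real.exp_eq_exp_ℝ]
    exact NormedSpace.expSeries_div_hasSum_exp t
  convert! h.mul_left (Real.exp (-t)) using 1
  rw [← Real.exp_add, neg_add_cancel, Real.exp_zero]

theorem tsum_ofReal_poissonWeight {t : ℝ} (ht : 0 ≤ t) :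
    ∑' n, ENNReal.ofReal (poissonWeight t n) = 1 := by
  rw [← ENNReal.ofReal_tsum_of_nonneg (poissonWeight_nonneg ht) (hasSum_poissonWeight t).summable,
    (hasSum_poissonWeight t).tsum_eq, ENNReal.ofReal_one]

theorem poissonWeight_le_one {t : ℝ} (ht : 0 ≤ t) (n : ℕ) : poissonWeight t n ≤ 1 :=
  le_hasSum (hasSum_poissonWeight t) n fun m _ => poissonWeight_nonneg ht m

/-- The function `t ↦ e^{-t} t^s` is maximal at `t = s`; this is `log r ≤ r - 1` at `r = t/s`. -/
theorem exp_neg_mul_rpow_le {s t : ℝ} (hs : 0 < s) (ht : 0 < t) :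
    Real.exp (-t) * t ^ s ≤ Real.exp (-s) * s ^ s := by
  rw [Real.rpow_def_of_pos ht, Real.rpow_def_of_pos hs, ← Real.exp_add, ← Real.exp_add,
    Real.exp_le_exp]
  have h := Real.log_le_sub_one_of_pos (div_pos ht hs)
  rw [Real.log_div ht.ne' hs.ne'] at h
  have h2 := mul_le_mul_of_nonneg_right h hs.le
  rw [sub_mul, sub_mul, div_mul_cancel₀ _ hs.ne'] at h2
  linarith

/-- Stirling's lower bound for `n!`: passing from `n` to `n + 1/2` in the base costs at most a
factor `e`, and the remaining `e^{1/2}` is below `√(2π)`. The case `n = 0` is separate because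
Stirling's bound vanishes there. -/
theorem exp_neg_mul_rpow_add_half_le (n : ℕ) :
    Real.exp (-((n : ℝ) + 1 / 2)) * ((n : ℝ) + 1 / 2) ^ ((n : ℝ) + 1 / 2) ≤ n.factorial := by
  rcases Nat.eq_zero_or_pos n with rfl | hn
  · norm_num
    refine mul_le_one₀ (Real.exp_le_one_iff.2 (by norm_num)) (by positivity) ?_
    exact Real.rpow_le_one (by norm_num) (by norm_num) (by norm_num)
  have hn' : (1 : ℝ) ≤ n := by exact_mod_cast hn
  have hn0 : (0 : ℝ) < n := by linarith
  refine le_trans ?_ (Stirling.le_factorial_stirling n)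
  have hpi : Real.exp 1 ≤ 2 * Real.pi := by
    have := Real.exp_one_lt_d9; have := Real.pi_gt_three; linarith
  have e1 : √(2 * Real.pi * n) * (n / Real.exp 1) ^ n =
      √(2 * Real.pi) * (Real.exp (-n) * (n : ℝ) ^ ((n : ℝ) + 1 / 2)) := by
    rw [Real.rpow_add hn0, Real.rpow_natCast, ← Real.sqrt_eq_rpow, Real.sqrt_mul (by positivity),
      div_pow, ← Real.exp_nat_mul, mul_one, Real.exp_neg]
    field_simp
  rw [e1]
  have e2 : ((n : ℝ) + 1 / 2) ^ ((n : ℝ) + 1 / 2) ≤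
      (n : ℝ) ^ ((n : ℝ) + 1 / 2) * Real.exp 1 := by
    rw [Real.rpow_def_of_pos (by positivity), Real.rpow_def_of_pos hn0, ← Real.exp_add,
      Real.exp_le_exp]
    have h := Real.log_le_sub_one_of_pos (show 0 < ((n : ℝ) + 1 / 2) / n by positivity)
    rw [Real.log_div (by positivity) hn0.ne', add_div, div_self hn0.ne', add_sub_cancel_left] at h
    have h2 := mul_le_mul_of_nonneg_right h (show 0 ≤ (n : ℝ) + 1 / 2 by positivity)
    have h3 : 1 / 2 / (n : ℝ) * (n + 1 / 2) ≤ 1 := by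
      rw [div_mul_eq_mul_div, div_le_one hn0]; linarith
    linarith
  have e3 : Real.exp (1 / 2) ≤ √(2 * Real.pi) := by
    refine Real.le_sqrt_of_sq_le ?_
    rw [← Real.exp_nat_mul]; norm_num; linarith
  calc Real.exp (-((n : ℝ) + 1 / 2)) * ((n : ℝ) + 1 / 2) ^ ((n : ℝ) + 1 / 2)
      ≤ Real.exp (-((n : ℝ) + 1 / 2)) * ((n : ℝ) ^ ((n : ℝ) + 1 / 2) * Real.exp 1) := by gcongr
    _ = Real.exp (1 / 2) * (Real.exp (-n) * (n : ℝ) ^ ((n : ℝ) + 1 / 2)) := by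
        rw [mul_comm _ (Real.exp 1), ← mul_assoc, ← Real.exp_add, ← mul_assoc, ← Real.exp_add]
        ring_nf
    _ ≤ _ := by gcongr

/-- For `t ≥ 1`, the two preceding bounds with `s = n + 1/2` give `√t · poissonWeight t n ≤ 1`; for
`t ≤ 1` the weight is at most `1`. The factor `√2` replaces `t` by `t + 1`. -/
theorem poissonWeight_le {t : ℝ} (ht : 0 ≤ t) (n : ℕ) :
    poissonWeight t n ≤ √2 * (t + 1) ^ (-(1 / 2) : ℝ) := by
  rw [Real.rpow_neg (by linarith), ← Real.sqrt_eq_rpow, ← div_eq_mul_inv,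
    le_div_iff₀ (Real.sqrt_pos.2 (by linarith))]
  rcases le_total t 1 with h1 | h1
  · calc poissonWeight t n * √(t + 1) ≤ 1 * √2 := by
          gcongr
          · exact poissonWeight_le_one ht n
          · linarith
      _ = _ := one_mul _
  · have ht0 : 0 < t := by linarith
    have h2 : √(t + 1) ≤ √2 * √t := by
      rw [← Real.sqrt_mul (by norm_num)]
      exact Real.sqrt_le_sqrt (by linarith)
    have h3 := exp_neg_mul_rpow_le (show (0 : ℝ) < n + 1 / 2 by positivity) ht0
    have h4 := h3.trans (exp_neg_mul_rpow_add_half_le n)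
    rw [Real.rpow_add ht0, Real.rpow_natCast, ← Real.sqrt_eq_rpow] at h4
    have hf : (0 : ℝ) < n.factorial := by positivity
    calc poissonWeight t n * √(t + 1) ≤ poissonWeight t n * (√2 * √t) := by
          gcongr; exact poissonWeight_nonneg ht n
      _ = √2 * (Real.exp (-t) * (t ^ n * √t) / n.factorial) := by unfold poissonWeight; ring
      _ ≤ √2 * 1 := by gcongr; rwa [div_le_one hf]
      _ = _ := mul_one _

end Poisson

/-! ### Convolution inequality and the product Poisson kernel -/

section Kernel

theorem tsum_pi_prod {d : ℕ} {α : Type*} (f : Fin d → α → ℝ≥0∞) :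
    ∑' x : Fin d → α, ∏ i, f i (x i) = ∏ i, ∑' k, f i k := by
  induction d with
  | zero => simp
  | succ d ih =>
    rw [← (Fin.consEquiv fun _ : Fin (d + 1) => α).tsum_eq, ENNReal.tsum_prod', Fin.prod_univ_succ,
      ← ih, ← ENNReal.tsum_mul_right]
    refine tsum_congr fun a => ?_
    rw [← ENNReal.tsum_mul_left]
    refine tsum_congr fun b => ?_
    simp [Fin.consEquiv, Fin.prod_univ_succ]

theorem ennreal_two_mul_le (a b : ℝ≥0∞) : 2 * (a * b) ≤ a ^ 2 + b ^ 2 := by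
  induction a with
  | top => simp
  | coe a =>
    induction b with
    | top => simp
    | coe b =>
      have := two_mul_le_add_sq a b
      rw [mul_assoc] at this
      exact_mod_cast this

/-- Cauchy–Schwarz with weight `g`, by expanding into a double sum and using `2ab ≤ a² + b²`;
infinite values are allowed. -/
theorem tsum_mul_sq_le {α : Type*} (f g : α → ℝ≥0∞) :
    (∑' y, f y * g y) ^ 2 ≤ (∑' y, f y ^ 2 * g y) * ∑' y, g y := by
  have hl : (∑' y, f y * g y) ^ 2 = ∑' y, ∑' z, f y * f z * (g y * g z) := by
    rw [sq, ← ENNReal.tsum_mul_right]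
    refine tsum_congr fun y => ?_
    rw [← ENNReal.tsum_mul_left]
    exact tsum_congr fun z => by ring
  have h1 : (∑' y, f y ^ 2 * g y) * ∑' y, g y = ∑' y, ∑' z, f y ^ 2 * (g y * g z) := by
    rw [← ENNReal.tsum_mul_right]
    refine tsum_congr fun y => ?_
    rw [← ENNReal.tsum_mul_left]
    exact tsum_congr fun z => by ring
  have h2 : (∑' y, f y ^ 2 * g y) * ∑' y, g y = ∑' y, ∑' z, f z ^ 2 * (g y * g z) := by
    rw [h1, ENNReal.tsum_comm]
    exact tsum_congr fun y => tsum_congr fun z => by ring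
  have h3 : 2 * (∑' y, f y * g y) ^ 2 ≤ 2 * ((∑' y, f y ^ 2 * g y) * ∑' y, g y) := by
    rw [two_mul ((∑' y, f y ^ 2 * g y) * _)]
    nth_rewrite 1 [h1]
    rw [h2, hl, ← ENNReal.tsum_add, ← ENNReal.tsum_mul_left]
    refine ENNReal.tsum_le_tsum fun y => ?_
    rw [← ENNReal.tsum_add, ← ENNReal.tsum_mul_left]
    refine ENNReal.tsum_le_tsum fun z => ?_
    rw [← add_mul, ← mul_assoc]
    gcongr
    exact ennreal_two_mul_le _ _
  exact (ENNReal.mul_le_mul_iff_right two_ne_zero ENNReal.ofNat_ne_top).1 h3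

theorem tsum_convolution_sq_le {G : Type*} [AddCommGroup G] (K g : G → ℝ≥0∞) :
    ∑' x, (∑' y, K (x - y) * g y) ^ 2 ≤ (∑' x, K x ^ 2) * (∑' y, g y) ^ 2 := by
  calc ∑' x, (∑' y, K (x - y) * g y) ^ 2
      ≤ ∑' x, (∑' y, K (x - y) ^ 2 * g y) * ∑' y, g y :=
        ENNReal.tsum_le_tsum fun x => tsum_mul_sq_le _ _
    _ = (∑' x, K x ^ 2) * (∑' y, g y) ^ 2 := by
        rw [ENNReal.tsum_mul_right, ENNReal.tsum_comm, sq, ← mul_assoc]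
        congr 1
        rw [← ENNReal.tsum_mul_left]
        refine tsum_congr fun y => ?_
        rw [ENNReal.tsum_mul_right, ← (Equiv.subRight y).tsum_eq fun x => K x ^ 2]
        rfl

/-- The Poisson weights, extended by zero to the integers. -/
noncomputable def poissonKernel (t : ℝ) (k : ℤ) : ℝ≥0∞ :=
  ∑' n : ℕ, ENNReal.ofReal (poissonWeight t n) * if k = n then 1 else 0

theorem tsum_poissonKernel {t : ℝ} (ht : 0 ≤ t) : ∑' k, poissonKernel t k = 1 := by
  unfold poissonKernel
  rw [ENNReal.tsum_comm]
  refine (tsum_congr fun n => ?_).trans (tsum_ofReal_poissonWeight ht)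
  rw [ENNReal.tsum_mul_left, tsum_ite_eq, mul_one]

theorem poissonKernel_le {t : ℝ} (ht : 0 ≤ t) (k : ℤ) :
    poissonKernel t k ≤ ENNReal.ofReal (√2 * (t + 1) ^ (-(1 / 2) : ℝ)) := by
  unfold poissonKernel
  by_cases hk : 0 ≤ k
  · lift k to ℕ using hk
    simp only [Nat.cast_inj, mul_ite, mul_one, mul_zero]
    rw [tsum_ite_eq' k]
    exact ENNReal.ofReal_le_ofReal (poissonWeight_le ht k)
  · have : ∀ n : ℕ, k ≠ n := fun n h => hk (by omega)
    simp [this]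

/-- The `ℓ²` norm squared is at most the supremum times the total mass. -/
theorem tsum_poissonKernel_sq_le {t : ℝ} (ht : 0 ≤ t) :
    ∑' k, poissonKernel t k ^ 2 ≤ ENNReal.ofReal (√2 * (t + 1) ^ (-(1 / 2) : ℝ)) := by
  calc ∑' k, poissonKernel t k ^ 2
      ≤ ∑' k, ENNReal.ofReal (√2 * (t + 1) ^ (-(1 / 2) : ℝ)) * poissonKernel t k := by
        refine ENNReal.tsum_le_tsum fun k => ?_
        rw [sq]
        gcongr
        exact poissonKernel_le ht k
    _ = _ := by rw [ENNReal.tsum_mul_left, tsum_poissonKernel ht, mul_one]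

/-- The product of one-dimensional Poisson kernels in the directions of `s` and of Dirac masses at
the origin in the other directions. -/
noncomputable def partialKernel {d : ℕ} (t : ℝ) (s : Finset (Fin d)) (x : Fin d → ℤ) : ℝ≥0∞ :=
  ∏ i, if i ∈ s then poissonKernel t (x i) else if x i = 0 then 1 else 0

theorem partialKernel_empty {d : ℕ} (t : ℝ) (x : Fin d → ℤ) :
    partialKernel t ∅ x = if x = 0 then 1 else 0 := by
  unfold partialKernel
  simp only [Finset.notMem_empty, if_false]
  rw [Finset.prod_boole]
  simp [funext_iff]

/-- Adjoining a direction convolves with one more Poisson law, matching one more factor of the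
operator exponential. -/
theorem partialKernel_insert {d : ℕ} (t : ℝ) {s : Finset (Fin d)} {i : Fin d} (hi : i ∉ s)
    (x : Fin d → ℤ) :
    partialKernel t (insert i s) x =
      ∑' n : ℕ, ENNReal.ofReal (poissonWeight t n) *
        partialKernel t s (x - (n : ℤ) • Pi.single i 1) := by
  have h1 : ∀ n : ℕ, partialKernel t s (x - (n : ℤ) • Pi.single i 1) =
      (if x i = n then 1 else 0) * ∏ j ∈ Finset.univ.erase i,
        if j ∈ s then poissonKernel t (x j) else if x j = 0 then 1 else 0 := by
    intro n
    unfold partialKernel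
    rw [← Finset.mul_prod_erase _ _ (Finset.mem_univ i)]
    congr 1
    · simp [hi, sub_eq_zero]
    · refine Finset.prod_congr rfl fun j hj => ?_
      have hj : j ≠ i := Finset.ne_of_mem_erase hj
      simp [hj]
  have h2 : partialKernel t (insert i s) x = poissonKernel t (x i) *
      ∏ j ∈ Finset.univ.erase i,
        if j ∈ s then poissonKernel t (x j) else if x j = 0 then 1 else 0 := by
    unfold partialKernel
    rw [← Finset.mul_prod_erase _ _ (Finset.mem_univ i)]
    congr 1
    · simp
    · refine Finset.prod_congr rfl fun j hj => ?_
      have hj : j ≠ i := Finset.ne_of_mem_erase hj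
      simp [hj]
  rw [h2]
  nth_rewrite 1 [poissonKernel]
  rw [← ENNReal.tsum_mul_right]
  exact tsum_congr fun n => by rw [h1, mul_assoc]

theorem tsum_partialKernel_univ_sq_le {d : ℕ} {t : ℝ} (ht : 0 ≤ t) :
    ∑' x : Fin d → ℤ, partialKernel t Finset.univ x ^ 2 ≤
      ENNReal.ofReal (√2 * (t + 1) ^ (-(1 / 2) : ℝ)) ^ d := by
  unfold partialKernel
  simp only [Finset.mem_univ, if_true, ← Finset.prod_pow]
  rw [tsum_pi_prod fun (_ : Fin d) k => poissonKernel t k ^ 2]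
  rw [Finset.prod_const, Finset.card_univ, Fintype.card_fin]
  gcongr
  exact tsum_poissonKernel_sq_le ht

end Kernel

/-- Used to commute `∂_x` with shifts: the change of variables by `τ` matches integrals over the
sets `τ ⁻¹' s`. -/
theorem condExp_comp_measurePreserving {α : Type*} {m m0 : MeasurableSpace α} {μ : Measure α}
    [IsFiniteMeasure μ] {τ : α → α} (hτ : MeasurePreserving τ μ μ) (hm : m ≤ m0) {f : α → ℝ}
    (hf : Integrable f μ) :
    μ[f ∘ τ | m.comap τ] =ᵐ[μ] μ[f | m] ∘ τ := by
  have hm' : m.comap τ ≤ m0 := (MeasurableSpace.comap_mono hm).trans hτ.measurable.comap_le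
  have hg : Integrable (μ[f | m] ∘ τ) μ := hτ.integrable_comp_of_integrable integrable_condExp
  refine (ae_eq_condExp_of_forall_setIntegral_eq hm' (hτ.integrable_comp_of_integrable hf)
    (fun s _ _ => hg.integrableOn) ?_ ?_).symm
  · rintro _ ⟨s, hs, rfl⟩ _
    have key : ∀ g : α → ℝ, AEStronglyMeasurable g μ →
        ∫ x in τ ⁻¹' s, g (τ x) ∂μ = ∫ x in s, g x ∂μ := by
      intro g hg
      rw [← setIntegral_map (hm s hs) (by rwa [hτ.map_eq]) hτ.aemeasurable, hτ.map_eq]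
    simp only [Function.comp_apply]
    rw [key _ integrable_condExp.aestronglyMeasurable, key _ hf.aestronglyMeasurable,
      setIntegral_condExp hm hf hs]
  · exact (stronglyMeasurable_condExp.comp_measurable
      (comap_measurable τ)).aestronglyMeasurable

variable {d : ℕ} {lam : ℝ} {P : Measure (Config d lam)}

/-! ### Shift operators on `L²(Ω)` -/

section Shift

theorem shift_shift (z w : Fin d → ℤ) (a : Config d lam) :
    shift z (shift w a) = shift (z + w) a := by
  funext x; simp [shift, add_assoc]

theorem shift_zero (a : Config d lam) : shift 0 a = a := by
  funext x; simp [shift]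

theorem shiftOp_ae (hP : Stationary P) (z : Fin d → ℤ) (u : L2 P) :
    shiftOp hP z u =ᵐ[P] u ∘ shift z :=
  Lp.coeFn_compMeasurePreserving u (hP z)

theorem shiftOp_apply_add (hP : Stationary P) (z w : Fin d → ℤ) (u : L2 P) :
    shiftOp hP (z + w) u = shiftOp hP z (shiftOp hP w u) := by
  refine Lp.ext ?_
  refine (shiftOp_ae hP _ u).trans ((shiftOp_ae hP z _).trans ?_).symm
  refine ((hP z).quasiMeasurePreserving.ae_eq_comp (shiftOp_ae hP w u)).trans ?_
  refine Eventually.of_forall fun a => ?_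
  simp [shift_shift, add_comm]

theorem shiftOp_zero_apply (hP : Stationary P) (u : L2 P) : shiftOp hP 0 u = u := by
  refine Lp.ext ((shiftOp_ae hP _ u).trans ?_)
  exact Eventually.of_forall fun a => by simp [shift_zero]

theorem norm_shiftOp_apply (hP : Stationary P) (z : Fin d → ℤ) (u : L2 P) :
    ‖shiftOp hP z u‖ = ‖u‖ :=
  (Lp.compMeasurePreservingₗᵢ ℝ (shift z) (hP z)).norm_map u

theorem norm_shiftOp_le (hP : Stationary P) (z : Fin d → ℤ) : ‖shiftOp hP z‖ ≤ 1 :=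
  ContinuousLinearMap.opNorm_le_bound _ zero_le_one fun u => by
    rw [norm_shiftOp_apply, one_mul]

theorem inner_shiftOp_left (hP : Stationary P) (z : Fin d → ℤ) (u v : L2 P) :
    inner ℝ (shiftOp hP z u) v = inner ℝ u (shiftOp hP (-z) v) := by
  have h : v = shiftOp hP z (shiftOp hP (-z) v) := by
    rw [← shiftOp_apply_add, add_neg_cancel, shiftOp_zero_apply]
  nth_rewrite 1 [h]
  exact LinearIsometry.inner_map_map (𝕜 := ℝ) (E := L2 P) (E' := L2 P)
    (Lp.compMeasurePreservingₗᵢ ℝ (shift z) (hP z)) u _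

theorem commute_shiftOp (hP : Stationary P) (z w : Fin d → ℤ) :
    Commute (shiftOp hP z) (shiftOp hP w) := by
  ext1 u
  rw [mul_apply_eq_comp, mul_apply_eq_comp, ← shiftOp_apply_add, ← shiftOp_apply_add, add_comm]

theorem shiftOp_pow_apply (hP : Stationary P) (z : Fin d → ℤ) (n : ℕ) (u : L2 P) :
    (shiftOp hP z ^ n) u = shiftOp hP ((n : ℤ) • z) u := by
  induction n with
  | zero => simp [shiftOp_zero_apply]
  | succ n ih =>
    rw [pow_succ', mul_apply_eq_comp, ih, ← shiftOp_apply_add]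
    congr 2
    push_cast
    rw [add_smul, one_smul, add_comm]

theorem shiftOp_const [IsProbabilityMeasure P] (hP : Stationary P) (z : Fin d → ℤ) (c : ℝ) :
    shiftOp hP z (Lp.const 2 P c) = Lp.const 2 P c := by
  refine Lp.ext ((shiftOp_ae hP z _).trans ?_)
  refine ((hP z).quasiMeasurePreserving.ae_eq_comp (Lp.coeFn_const _ _ _)).trans ?_
  exact (Lp.coeFn_const 2 P c).symm

/-- The expectation as a continuous linear functional on `L²(Ω)`. -/
noncomputable def meanOp (P : Measure (Config d lam)) [IsProbabilityMeasure P] : L2 P →L[ℝ] ℝ :=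
  innerSL ℝ (Lp.const 2 P (1 : ℝ))

theorem meanOp_apply [IsProbabilityMeasure P] (u : L2 P) : meanOp P u = ∫ a, u a ∂P := by
  rw [meanOp, innerSL_apply_apply, L2.inner_def]
  simp

theorem meanOp_shiftOp [IsProbabilityMeasure P] (hP : Stationary P) (z : Fin d → ℤ) (u : L2 P) :
    meanOp P (shiftOp hP z u) = meanOp P u := by
  rw [meanOp, innerSL_apply_apply, innerSL_apply_apply, real_inner_comm, inner_shiftOp_left,
    real_inner_comm, shiftOp_const]

end Shift

/-! ### Vertical derivatives and their commutation with shifts -/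

section Vertical

theorem sigmaAway_le (x : Fin d → ℤ) :
    sigmaAway d lam x ≤ (inferInstance : MeasurableSpace (Config d lam)) :=
  iSup₂_le fun z _ => (measurable_pi_apply z).comap_le

theorem comap_shift_sigmaAway (x z : Fin d → ℤ) :
    (sigmaAway d lam x).comap (shift z) = sigmaAway d lam (x + z) := by
  unfold sigmaAway
  simp only [MeasurableSpace.comap_iSup, MeasurableSpace.comap_comp]
  refine (Equiv.addRight z).iSup_congr fun w => ?_
  exact iSup_congr_Prop (by simp) fun _ => rfl

/-- The vertical derivative `∂_x` as a bounded operator on `L²(Ω)`. -/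
noncomputable def vertOp (P : Measure (Config d lam)) (x : Fin d → ℤ) : L2 P →L[ℝ] L2 P :=
  ContinuousLinearMap.id ℝ (L2 P) -
    (Submodule.subtypeL (lpMeas ℝ ℝ (sigmaAway d lam x) 2 P)).comp
      (condExpL2 ℝ ℝ (sigmaAway_le x))

theorem vertOp_ae [IsProbabilityMeasure P] (x : Fin d → ℤ) (u : L2 P) :
    vertOp P x u =ᵐ[P] vertD P x u := by
  have h := (Lp.memLp u).condExpL2_ae_eq_condExp (𝕜 := ℝ) (sigmaAway_le x)
  rw [Lp.toLp_coeFn] at h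
  refine (Lp.coeFn_sub u _).trans ?_
  filter_upwards [h] with a ha
  simp only [Pi.sub_apply, vertD, ← ha]
  rfl

theorem eLpNorm_vertD [IsProbabilityMeasure P] (x : Fin d → ℤ) (u : L2 P) :
    eLpNorm (vertD P x u) 2 P = ‖vertOp P x u‖ₑ := by
  rw [Lp.enorm_def, eLpNorm_congr_ae (vertOp_ae x u)]

theorem vertOp_shiftOp [IsProbabilityMeasure P] (hP : Stationary P) (x z : Fin d → ℤ) (u : L2 P) :
    vertOp P x (shiftOp hP z u) = shiftOp hP z (vertOp P (x - z) u) := by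
  refine Lp.ext ?_
  have hu : Integrable u P := (Lp.memLp u).integrable one_le_two
  have h1 : P[shiftOp hP z u | sigmaAway d lam x] =ᵐ[P]
      P[u | sigmaAway d lam (x - z)] ∘ shift z := by
    refine (condExp_congr_ae (shiftOp_ae hP z u)).trans ?_
    have := condExp_comp_measurePreserving (hP z) (sigmaAway_le (x - z)) hu
    rwa [comap_shift_sigmaAway, sub_add_cancel] at this
  refine (vertOp_ae x _).trans (((shiftOp_ae hP z _).trans
    ((hP z).quasiMeasurePreserving.ae_eq_comp (vertOp_ae _ u))).trans ?_).symm
  filter_upwards [h1, shiftOp_ae hP z u] with a h1 h2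
  simp only [vertD, h1, h2, Function.comp_apply]

/-- `exp(t(S_e - 1))` is the Poisson average of the powers of `S_e`. Moving `∂_x` past `S_e^n` turns
it into `∂_{x-ne}`, and the shift is isometric. -/
theorem enorm_vertOp_exp_le [IsProbabilityMeasure P] (hP : Stationary P) {t : ℝ} (ht : 0 ≤ t)
    (x e : Fin d → ℤ) (u : L2 P) :
    ‖vertOp P x (NormedSpace.exp (t • (shiftOp hP e - 1)) u)‖ₑ ≤
      ∑' n : ℕ, ENNReal.ofReal (poissonWeight t n) * ‖vertOp P (x - (n : ℤ) • e) u‖ₑ := by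
  have h0 := exp_smul_sub_smul_one (shiftOp hP e) t 1
  rw [one_smul, mul_one] at h0
  have h1 := (hasSum_map_exp_apply (vertOp P x) (t • shiftOp hP e) u).const_smul (Real.exp (-t))
  have h2 : ∀ n : ℕ, Real.exp (-t) • ((n.factorial : ℝ)⁻¹) •
      vertOp P x (((t • shiftOp hP e) ^ n) u) =
      poissonWeight t n • shiftOp hP ((n : ℤ) • e) (vertOp P (x - (n : ℤ) • e) u) := by
    intro n
    rw [smul_pow, smul_apply, shiftOp_pow_apply, map_smul, vertOp_shiftOp, smul_smul, smul_smul,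
      poissonWeight]
    congr 1
    ring
  simp only [h2] at h1
  rw [h0, smul_apply, map_smul, ← h1.tsum_eq]
  refine (enorm_tsum_le_tsum_enorm).trans (ENNReal.tsum_le_tsum fun n => ?_)
  rw [enorm_smul, Real.enorm_of_nonneg (poissonWeight_nonneg ht n)]
  gcongr
  rw [← ofReal_norm, ← ofReal_norm, norm_shiftOp_apply]

end Vertical

/-! ### The operator `D*D`, its kernel and ergodicity -/

section Horizontal

theorem horizD_apply (hP : Stationary P) (u : L2 P) (i : Fin d) :
    horizD hP u i = shiftOp hP (Pi.single i 1) u - u := rfl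

theorem horizDstar_horizD_apply (hP : Stationary P) (u : L2 P) :
    horizDstar hP (horizD hP u) =
      ∑ i : Fin d, (u - shiftOp hP (Pi.single i 1) u + (u - shiftOp hP (-Pi.single i 1) u)) := by
  simp only [horizDstar, sum_apply, ContinuousLinearMap.comp_apply,
    ContinuousLinearMap.proj_apply, horizD_apply, sub_apply, ContinuousLinearMap.id_apply]
  refine Finset.sum_congr rfl fun i _ => ?_
  rw [map_sub, ← shiftOp_apply_add, neg_add_cancel, shiftOp_zero_apply]
  abel

theorem neg_smul_horizDstar_comp_horizD (hP : Stationary P) (t : ℝ) :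
    (-t) • (horizDstar hP).comp (horizD hP) =
      t • ((∑ i : Fin d, (shiftOp hP (Pi.single i 1) + shiftOp hP (-Pi.single i 1))) -
        (2 * d : ℝ) • (1 : L2 P →L[ℝ] L2 P)) := by
  ext1 u
  rw [neg_smul, ← smul_neg, smul_apply, smul_apply]
  congr 1
  rw [neg_apply, ContinuousLinearMap.comp_apply, horizDstar_horizD_apply, sub_apply,
    sum_apply, smul_apply, one_apply_eq_self]
  simp only [Finset.sum_add_distrib, Finset.sum_sub_distrib, add_apply, Finset.sum_const,
    Finset.card_univ, Fintype.card_fin, two_mul, add_smul, Nat.cast_smul_eq_nsmul]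
  abel

theorem isSelfAdjoint_horizDstar_comp_horizD (hP : Stationary P) :
    IsSelfAdjoint ((horizDstar hP).comp (horizD hP)) := by
  rw [ContinuousLinearMap.isSelfAdjoint_iff_isSymmetric]
  intro u v
  simp only [ContinuousLinearMap.coe_coe, ContinuousLinearMap.comp_apply,
    horizDstar_horizD_apply, sum_inner, inner_sum]
  refine Finset.sum_congr rfl fun i _ => ?_
  rw [inner_add_left, inner_add_right, inner_sub_left, inner_sub_left, inner_sub_right,
    inner_sub_right, inner_shiftOp_left, inner_shiftOp_left, neg_neg]
  ring

theorem inner_horizDstar_horizD (hP : Stationary P) (u : L2 P) :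
    inner ℝ (horizDstar hP (horizD hP u)) u =
      ∑ i : Fin d, ‖shiftOp hP (Pi.single i 1) u - u‖ ^ 2 := by
  rw [horizDstar_horizD_apply, sum_inner]
  refine Finset.sum_congr rfl fun i _ => ?_
  rw [norm_sub_sq_real, norm_shiftOp_apply, inner_add_left, inner_sub_left, inner_sub_left,
    inner_shiftOp_left hP (-_), neg_neg, real_inner_self_eq_norm_sq, real_inner_comm _ u]
  ring

theorem norm_semigroup_apply_le (hP : Stationary P) {t : ℝ} (ht : 0 ≤ t) (u : L2 P) :
    ‖semigroup hP t u‖ ≤ ‖u‖ := by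
  rw [semigroup, neg_smul_horizDstar_comp_horizD]
  refine norm_exp_smul_sub_apply_le ?_ ht u
  refine (norm_sum_le _ _).trans ?_
  calc ∑ i : Fin d, ‖shiftOp hP (Pi.single i 1) + shiftOp hP (-Pi.single i 1)‖
      ≤ ∑ i : Fin d, (1 + 1 : ℝ) := Finset.sum_le_sum fun i _ =>
        (norm_add_le _ _).trans (add_le_add (norm_shiftOp_le hP _) (norm_shiftOp_le hP _))
    _ = 2 * d := by simp; ring

theorem shiftOp_eq_self_of_horizDstar_horizD_eq_zero (hP : Stationary P) {u : L2 P}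
    (hu : horizDstar hP (horizD hP u) = 0) (z : Fin d → ℤ) : shiftOp hP z u = u := by
  have h0 := inner_horizDstar_horizD hP u
  rw [hu, inner_zero_left, eq_comm, Finset.sum_eq_zero_iff_of_nonneg fun i _ => by positivity]
    at h0
  have h1 : ∀ i : Fin d, shiftOp hP (Pi.single i 1) u = u := fun i => by
    have := h0 i (Finset.mem_univ i)
    rwa [sq_eq_zero_iff, norm_eq_zero, sub_eq_zero] at this
  -- The shifts fixing `u` form a subgroup, and the unit vectors generate `ℤ^d`.
  let G : AddSubgroup (Fin d → ℤ) :=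
    { carrier := {z | shiftOp hP z u = u}
      add_mem' := fun {a b} ha hb => by
        rw [Set.mem_ofPred_eq] at *
        rw [shiftOp_apply_add, hb, ha]
      zero_mem' := shiftOp_zero_apply hP u
      neg_mem' := fun {a} ha => by
        rw [Set.mem_ofPred_eq] at *
        nth_rewrite 1 [← ha]
        rw [← shiftOp_apply_add, neg_add_cancel, shiftOp_zero_apply] }
  have hz : z = ∑ i, z i • (Pi.single i 1 : Fin d → ℤ) := by
    funext j
    simp [Finset.sum_apply, Pi.single_apply]
  have : z ∈ G := by
    rw [hz]
    exact G.sum_mem fun i _ => G.zsmul_mem (h1 i) _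
  exact this

theorem IsErgodic.exists_ae_eq_const [IsProbabilityMeasure P] (hP : Stationary P)
    (he : IsErgodic P) {u : L2 P} (hu : ∀ z, shiftOp hP z u = u) :
    ∃ c : ℝ, u =ᵐ[P] fun _ => c := by
  have hinv : ∀ᵐ a ∂P, ∀ z, u (shift z a) = u a := by
    rw [ae_all_iff]
    intro z
    have h := shiftOp_ae hP z u
    rw [hu z] at h
    filter_upwards [h] with a ha using ha.symm
  refine exists_eventuallyEq_const_of_forall_separating MeasurableSet fun U hU => ?_
  -- Since `u` is invariant only almost everywhere, `{u ∈ U}` need not be invariant; asking for the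
  -- whole orbit gives a strictly invariant set that agrees with it almost surely.
  set A : Set (Config d lam) := {a | ∀ z, u (shift z a) ∈ U} with hA
  have hAm : MeasurableSet A := by
    rw [hA, Set.ofPred_forall]
    exact MeasurableSet.iInter fun z =>
      ((Lp.stronglyMeasurable u).measurable.comp (hP z).measurable) hU
  have hAi : ∀ w, shift w ⁻¹' A = A := by
    intro w
    ext a
    simp only [hA, Set.mem_preimage, Set.mem_ofPred_eq, shift_shift]
    exact (Equiv.addRight w).forall_congr fun z => Iff.rfl
  have hiff : ∀ᵐ a ∂P, a ∈ A ↔ u a ∈ U := by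
    filter_upwards [hinv] with a ha
    simp [hA, ha]
  rcases he A hAm hAi with h | h
  · right
    filter_upwards [hiff, measure_eq_zero_iff_ae_notMem.1 h] with a h1 h2
    rwa [← h1]
  · left
    filter_upwards [hiff, (mem_ae_iff_prob_eq_one hAm).2 h] with a h1 h2
    exact h1.1 h2

end Horizontal

/-! ### Splitting the semigroup into one-sided Poisson averages -/

theorem commute_smul_shiftOp_sub_one (hP : Stationary P) (s t : ℝ) (z w : Fin d → ℤ) :
    Commute (s • (shiftOp hP z - 1)) (t • (shiftOp hP w - 1)) :=
  ((((commute_shiftOp hP z w).sub_right (Commute.one_right _)).sub_left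
    (Commute.one_left _)).smul_left s).smul_right t

theorem enorm_vertOp_exp_sum_le [IsProbabilityMeasure P] (hP : Stationary P) {t : ℝ} (ht : 0 ≤ t)
    (s : Finset (Fin d)) (x : Fin d → ℤ) (u : L2 P) :
    ‖vertOp P x (NormedSpace.exp (∑ i ∈ s, t • (shiftOp hP (Pi.single i 1) - 1)) u)‖ₑ ≤
      ∑' y, partialKernel t s (x - y) * ‖vertOp P y u‖ₑ := by
  let _ : NormedAlgebra ℚ (L2 P →L[ℝ] L2 P) := NormedAlgebra.restrictScalars ℚ ℝ _
  induction s using Finset.induction_on generalizing x with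
  | empty =>
    rw [Finset.sum_empty, NormedSpace.exp_zero, one_apply_eq_self]
    refine le_trans ?_ (ENNReal.le_tsum x)
    simp [partialKernel_empty]
  | insert i s hi ih =>
    rw [Finset.sum_insert hi, NormedSpace.exp_add_of_commute
      (Commute.sum_right _ _ _ fun j _ => commute_smul_shiftOp_sub_one hP _ _ _ _),
      mul_apply_eq_comp]
    refine (enorm_vertOp_exp_le hP ht x (Pi.single i 1) _).trans ?_
    have hle := fun n : ℕ => ih (x - (n : ℤ) • Pi.single i 1)
    generalize NormedSpace.exp (∑ i ∈ s, t • (shiftOp hP (Pi.single i 1) - 1)) u = v at hle ⊢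
    calc ∑' n : ℕ, ENNReal.ofReal (poissonWeight t n) *
          ‖vertOp P (x - (n : ℤ) • Pi.single i 1) v‖ₑ
        ≤ ∑' n : ℕ, ENNReal.ofReal (poissonWeight t n) *
          ∑' y, partialKernel t s (x - (n : ℤ) • Pi.single i 1 - y) * ‖vertOp P y u‖ₑ :=
          ENNReal.tsum_le_tsum fun n => by gcongr; exact hle n
      _ = _ := by
          simp_rw [← ENNReal.tsum_mul_left]
          rw [ENNReal.tsum_comm]
          refine tsum_congr fun y => ?_
          rw [partialKernel_insert t hi, ← ENNReal.tsum_mul_right]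
          refine tsum_congr fun n => ?_
          rw [mul_assoc, sub_right_comm]

theorem semigroup_eq_mul (hP : Stationary P) (t : ℝ) :
    semigroup hP t =
      NormedSpace.exp (∑ i : Fin d, t • (shiftOp hP (-Pi.single i 1) - 1)) *
        NormedSpace.exp (∑ i : Fin d, t • (shiftOp hP (Pi.single i 1) - 1)) := by
  let _ : NormedAlgebra ℚ (L2 P →L[ℝ] L2 P) := NormedAlgebra.restrictScalars ℚ ℝ _
  rw [← NormedSpace.exp_add_of_commute (Commute.sum_left _ _ _ fun i _ =>
    Commute.sum_right _ _ _ fun j _ => commute_smul_shiftOp_sub_one hP _ _ _ _), semigroup]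
  congr 1
  rw [neg_smul_horizDstar_comp_horizD, ← Finset.smul_sum, ← Finset.smul_sum, ← smul_add]
  congr 1
  simp only [Finset.sum_add_distrib, Finset.sum_sub_distrib, Finset.sum_const, Finset.card_univ,
    Fintype.card_fin, two_mul, add_smul, Nat.cast_smul_eq_nsmul]
  abel

theorem norm_exp_sum_shiftOp_sub_one_apply_le (hP : Stationary P) {t : ℝ} (ht : 0 ≤ t)
    (z : Fin d → Fin d → ℤ) (u : L2 P) :
    ‖NormedSpace.exp (∑ i : Fin d, t • (shiftOp hP (z i) - 1)) u‖ ≤ ‖u‖ := by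
  have h : ∑ i : Fin d, t • (shiftOp hP (z i) - 1) =
      t • ((∑ i : Fin d, shiftOp hP (z i)) - (d : ℝ) • (1 : L2 P →L[ℝ] L2 P)) := by
    rw [← Finset.smul_sum, Finset.sum_sub_distrib, Finset.sum_const, Finset.card_univ,
      Fintype.card_fin, Nat.cast_smul_eq_nsmul]
  rw [h]
  refine norm_exp_smul_sub_apply_le ((norm_sum_le _ _).trans ?_) ht u
  refine (Finset.sum_le_sum fun i _ => norm_shiftOp_le hP (z i)).trans ?_
  simp

theorem exp_sum_shiftOp_sub_one_const [IsProbabilityMeasure P] (hP : Stationary P) (t c : ℝ)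
    (z : Fin d → Fin d → ℤ) :
    NormedSpace.exp (∑ i : Fin d, t • (shiftOp hP (z i) - 1)) (Lp.const 2 P c) =
      Lp.const 2 P c := by
  refine exp_apply_of_apply_eq_zero ?_
  rw [sum_apply]
  refine Finset.sum_eq_zero fun i _ => ?_
  rw [smul_apply, sub_apply, shiftOp_const, one_apply_eq_self, sub_self, smul_zero]

theorem meanOp_exp_sum_shiftOp_sub_one [IsProbabilityMeasure P] (hP : Stationary P) (t : ℝ)
    (z : Fin d → Fin d → ℤ) (u : L2 P) :
    meanOp P (NormedSpace.exp (∑ i : Fin d, t • (shiftOp hP (z i) - 1)) u) = meanOp P u := by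
  refine map_exp_apply_of_comp_eq_zero (fun v => ?_) u
  rw [sum_apply, map_sum]
  refine Finset.sum_eq_zero fun i _ => ?_
  rw [smul_apply, sub_apply, map_smul, map_sub, meanOp_shiftOp, one_apply_eq_self, sub_self,
    smul_zero]

/-! ### Proofs of (a) and (b) -/

theorem coeFn_sub_const [IsProbabilityMeasure P] (u : L2 P) (c : ℝ) :
    (u - Lp.const 2 P c : L2 P) =ᵐ[P] fun a => u a - c := by
  filter_upwards [Lp.coeFn_sub u (Lp.const 2 P c), Lp.coeFn_const 2 P c] with a h1 h2
  rw [h1, Pi.sub_apply, h2, Function.const_apply]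

theorem eLpNorm_sub_const [IsProbabilityMeasure P] (u : L2 P) (c : ℝ) :
    eLpNorm (fun a => u a - c) 2 P = ‖u - Lp.const 2 P c‖ₑ := by
  rw [Lp.enorm_def, eLpNorm_congr_ae (coeFn_sub_const u c)]

theorem integral_abs_sub_const_sq [IsProbabilityMeasure P] (u : L2 P) (c : ℝ) :
    ∫ a, |u a - c| ^ 2 ∂P = ‖u - Lp.const 2 P c‖ ^ 2 := by
  rw [← real_inner_self_eq_norm_sq, L2.inner_def]
  refine integral_congr_ae ?_
  filter_upwards [coeFn_sub_const u c] with a ha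
  rw [ha, real_inner_self_eq_norm_sq, Real.norm_eq_abs]

theorem isErgodic_iff_tendsto_semigroup [IsProbabilityMeasure P] (hP : Stationary P) :
    IsErgodic P ↔ ∀ ζ : L2 P,
      Tendsto (fun t : ℝ => ∫ a, |semigroup hP t ζ a - ∫ b, ζ b ∂P| ^ 2 ∂P) atTop (𝓝 0) := by
  simp only [integral_abs_sub_const_sq]
  constructor
  · intro he ζ
    obtain ⟨y, hy0, hy⟩ := exists_tendsto_exp_neg_smul (isSelfAdjoint_horizDstar_comp_horizD hP)
      (fun t ht v => norm_semigroup_apply_le hP ht v) ζ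
    obtain ⟨c, hc⟩ := he.exists_ae_eq_const hP
      (shiftOp_eq_self_of_horizDstar_horizD_eq_zero hP hy0)
    have hmean : ∀ t, meanOp P (semigroup hP t ζ) = meanOp P ζ := fun t => by
      rw [semigroup_eq_mul, mul_apply_eq_comp, meanOp_exp_sum_shiftOp_sub_one,
        meanOp_exp_sum_shiftOp_sub_one]
    have hyc : y = Lp.const 2 P (∫ b, ζ b ∂P) := by
      have h1 : meanOp P y = meanOp P ζ :=
        tendsto_nhds_unique (((meanOp P).continuous.tendsto y).comp hy)
          (tendsto_const_nhds.congr fun t => (hmean t).symm)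
      rw [meanOp_apply, meanOp_apply, integral_congr_ae hc, integral_const, probReal_univ,
        one_smul] at h1
      rw [← h1]
      exact Lp.ext (hc.trans (Lp.coeFn_const 2 P c).symm)
    have h2 := ((hy.sub_const (Lp.const 2 P (∫ b, ζ b ∂P))).norm).pow 2
    rw [hyc, sub_self, norm_zero, zero_pow two_ne_zero] at h2
    exact h2
  · intro h A hA hAi
    set ζ : L2 P := indicatorConstLp 2 hA (measure_ne_top P A) (1 : ℝ) with hζ
    have hζA : ζ =ᵐ[P] A.indicator fun _ => (1 : ℝ) := indicatorConstLp_coeFn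
    have hs : ∀ z, shiftOp hP z ζ = ζ := by
      intro z
      refine Lp.ext ((shiftOp_ae hP z ζ).trans ?_)
      refine ((hP z).quasiMeasurePreserving.ae_eq_comp hζA).trans (EventuallyEq.trans ?_ hζA.symm)
      refine Eventually.of_forall fun a => ?_
      have ha : shift z a ∈ A ↔ a ∈ A := Set.ext_iff.1 (hAi z) a
      rw [Function.comp_apply]
      by_cases hmem : a ∈ A
      · rw [Set.indicator_of_mem hmem, Set.indicator_of_mem (ha.2 hmem)]
      · rw [Set.indicator_of_notMem hmem, Set.indicator_of_notMem (mt ha.1 hmem)]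
    have hfix : ∀ t, semigroup hP t ζ = ζ := by
      intro t
      refine exp_apply_of_apply_eq_zero ?_
      rw [smul_apply, ContinuousLinearMap.comp_apply, horizDstar_horizD_apply]
      simp [hs]
    have h0 := h ζ
    simp only [hfix] at h0
    -- A constant function of `t` tending to `0` is `0`, so the indicator equals its mean.
    have h1 := tendsto_nhds_unique tendsto_const_nhds h0
    rw [sq_eq_zero_iff, norm_eq_zero, sub_eq_zero] at h1
    have h2 : A.indicator (fun _ => (1 : ℝ)) =ᵐ[P] fun _ => ∫ b, ζ b ∂P := by
      refine hζA.symm.trans ?_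
      nth_rewrite 1 [h1]
      exact Lp.coeFn_const 2 P _
    by_cases hc : ∫ b, ζ b ∂P = 1
    · right
      rw [← mem_ae_iff_prob_eq_one hA]
      filter_upwards [h2] with a ha
      by_contra hna
      rw [Set.indicator_of_notMem hna, hc] at ha
      exact zero_ne_one ha
    · left
      rw [measure_eq_zero_iff_ae_notMem]
      filter_upwards [h2] with a ha hmem
      rw [Set.indicator_of_mem hmem] at ha
      exact hc ha.symm

theorem SpectralGap.eLpNorm_semigroup_sub_le [IsProbabilityMeasure P] (hP : Stationary P) {ρ : ℝ}
    (hρ : 0 < ρ) (hSG : SpectralGap P ρ) (ζ : L2 P) {t : ℝ} (ht : 0 ≤ t) :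
    eLpNorm (fun a => semigroup hP t ζ a - ∫ b, ζ b ∂P) 2 P ≤
      ENNReal.ofReal (√(√2 ^ d) / √ρ * (t + 1) ^ (-(d : ℝ) / 4)) *
        ∑' x : Fin d → ℤ, eLpNorm (vertD P x ζ) 2 P := by
  set f : L2 P := NormedSpace.exp (∑ i : Fin d, t • (shiftOp hP (Pi.single i 1) - 1)) ζ with hf
  set c : ℝ := ∫ b, ζ b ∂P with hc
  have hfc : ∫ b, f b ∂P = c := by
    rw [hc, ← meanOp_apply, ← meanOp_apply, hf, meanOp_exp_sum_shiftOp_sub_one]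
  have h1 : ‖semigroup hP t ζ - Lp.const 2 P c‖ ≤ ‖f - Lp.const 2 P c‖ := by
    have := norm_exp_sum_shiftOp_sub_one_apply_le hP ht (fun i => -Pi.single i 1)
      (f - Lp.const 2 P c)
    rwa [map_sub, exp_sum_shiftOp_sub_one_const, hf, ← mul_apply_eq_comp, ← semigroup_eq_mul]
      at this
  have h2 := hSG f
  simp only [eLpNorm_vertD] at h2 ⊢
  rw [hfc, eLpNorm_sub_const] at h2
  rw [eLpNorm_sub_const]
  refine (enorm_le_iff_norm_le.2 h1).trans ?_
  have h3 : ∑' x : Fin d → ℤ, ‖vertOp P x f‖ₑ ^ 2 ≤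
      ENNReal.ofReal (√2 * (t + 1) ^ (-(1 / 2) : ℝ)) ^ d *
        (∑' y : Fin d → ℤ, ‖vertOp P y ζ‖ₑ) ^ 2 := by
    calc ∑' x : Fin d → ℤ, ‖vertOp P x f‖ₑ ^ 2
        ≤ ∑' x : Fin d → ℤ, (∑' y, partialKernel t Finset.univ (x - y) * ‖vertOp P y ζ‖ₑ) ^ 2 :=
          ENNReal.tsum_le_tsum fun x => by
            gcongr
            exact enorm_vertOp_exp_sum_le hP ht Finset.univ x ζ
      _ ≤ _ := tsum_convolution_sq_le _ _
      _ ≤ _ := by gcongr; exact tsum_partialKernel_univ_sq_le ht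
  have ht1 : 0 < t + 1 := by linarith
  -- The constant `√(√2 ^ d) = 2^{d/4}` is the square root of the factor `√2^d` from the `d`
  -- one-dimensional kernels.
  have h4 : (√(√2 ^ d) / √ρ * (t + 1) ^ (-(d : ℝ) / 4)) ^ 2 =
      1 / ρ * (√2 * (t + 1) ^ (-(1 / 2) : ℝ)) ^ d := by
    rw [mul_pow, div_pow, Real.sq_sqrt (by positivity), Real.sq_sqrt hρ.le, mul_pow,
      ← Real.rpow_natCast ((t + 1) ^ (-(d : ℝ) / 4)), ← Real.rpow_mul ht1.le,
      ← Real.rpow_natCast ((t + 1) ^ (-(1 / 2) : ℝ)), ← Real.rpow_mul ht1.le]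
    push_cast
    ring_nf
  refine (ENNReal.pow_le_pow_left_iff two_ne_zero).1 ?_
  rw [mul_pow, ← ENNReal.ofReal_pow (by positivity), h4, ENNReal.ofReal_mul (by positivity),
    ENNReal.ofReal_pow (by positivity), mul_assoc]
  exact h2.trans (by gcongr)

end DiscreteHomog

theorem lemma4 (d : ℕ) :
    (∀ (lam : ℝ) (_ : 0 < lam) (_ : lam < 1)
      (P : Measure (DiscreteHomog.Config d lam)) (_ : IsProbabilityMeasure P)
      (hP : DiscreteHomog.Stationary P),
      DiscreteHomog.IsErgodic P ↔
        ∀ ζ : DiscreteHomog.L2 P,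
          Tendsto
            (fun t : ℝ => ∫ a, |DiscreteHomog.semigroup hP t ζ a - ∫ b, ζ b ∂P| ^ 2 ∂P)
            atTop (𝓝 0)) ∧
    (∃ C : ℝ, 0 < C ∧
      ∀ (lam : ℝ) (_ : 0 < lam) (_ : lam < 1)
        (P : Measure (DiscreteHomog.Config d lam)) (_ : IsProbabilityMeasure P)
        (hP : DiscreteHomog.Stationary P)
        (ρ : ℝ) (_ : 0 < ρ) (_ : DiscreteHomog.SpectralGap P ρ)
        (ζ : DiscreteHomog.L2 P) (t : ℝ) (_ : 0 ≤ t),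
        eLpNorm (fun a => DiscreteHomog.semigroup hP t ζ a - ∫ b, ζ b ∂P) 2 P ≤
          ENNReal.ofReal (C / √ρ * (t + 1) ^ (-(d : ℝ) / 4)) *
            ∑' x : Fin d → ℤ, eLpNorm (DiscreteHomog.vertD P x ζ) 2 P) := by
  refine ⟨fun lam _ _ P _ hP => DiscreteHomog.isErgodic_iff_tendsto_semigroup hP,
    √(√2 ^ d), by positivity, fun lam _ _ P _ hP ρ hρ hSG ζ t ht => ?_⟩
  exact hSG.eLpNorm_semigroup_sub_le hP hρ ζ ht
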